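/- Let $q\ge 5$ be a prime power, let $0\le t\le q$, $5\le m\le q-1$ and $0\le \ell\le m-1$, and put $r=(q^2-q)/2$, $n=t+r$. List the elements of $\mathbb F_{q^2}$, without repetition, as $\alpha_1,\dots,\alpha_q,\beta_1,\beta_1^q,\dots,\beta_r,\beta_r^q$, where $\alpha_1,\dots,\alpha_q$ are the elements of $\mathbb F_q$. For $i,j\ge 0$ let $e_{i,j}(x)=x^{iq+j}+x^{jq+i}$ if $i\ne j$ and $e_{i,i}(x)=x^{iq+i}$. Define the $\mathbb F_q$-linear spaces of polynomials $$V_{m,\ell}=\big\langle \{e_{i,j}:0\le i\le j\le m-2\}\cup\{e_{i,m-1}:0\le i\le \ell\}\big\rangle,$$ $$\mathcal W_8=\langle 1,\;x^{q+1},\;x^{2(q+1)},\;x^{3(q+1)},\;x^q+x,\;x^{2q}+x^2,\;x^{3q}+x^3,\;x^{2q+1}+x^{q+2}\rangle,$$ and let $C_q(t,m,\ell)$ (the Xing–Ling code) and $\mathcal F$ be the $q$-ary linear codes of length $n$ consisting of the words $(f(\alpha_1),\dots,f(\alpha_t),f(\beta_1),\dots,f(\beta_r))\in\mathbb F_q^n$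 with $f\in V_{m,\ell}$, respectively $f\in\mathcal W_8$. Let $$\delta=n-\tfrac12\big(q(m-1)+\ell+g\big),\qquad g=\begin{cases}\min\{\max\{2(m-2),m+\ell-1\},t\}& q\text{ odd},\\ \max\{\min\{m-2,t\},2t-q\}& q\text{ even},\ \ell\le m-2,\\ \max\{\min\{m-1,t\},2t-q\}& q\text{ even},\ \ell=m-1.\end{cases}$$ On $(\mathbb C^q)^{\otimes n}$, with orthonormal basis $|u\rangle$, $u\in\mathbb F_q^n$, let $X(a)|u\rangle=|u+a\rangle$ and $Z(b)|u\rangle=\exp\big(2\pi i\,\mathrm{Tr}_{\mathbb F_q/\mathbb F_p}(b\cdot u)/p\big)|u\rangle$, where $p$ is the characteristic of $\mathbb F_q$. An asymmetric quantum code with parameters $[[n,k,\{d_z,d_x\}]]_q$ ($d_z,d_x\ge1$) is a stabilizer code $Q\subseteq(\mathbb C^q)^{\otimes n}$ of dimension $q^k$ that detects every error $X(a)Z(b)$ with $\mathrm{wt}(a)\le d_x-1$ and $\mathrm{wt}(b)\le d_z-1$, where $\mathrm{wt}$ is the Hamming weight. For linear codes $C_1^\perp\subseteq C_2\subseteq\mathbb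 F_q^n$ ($\perp$ is the Euclidean dual), the standard CSS code of $(C_1,C_2)$ is the joint $+1$-eigenspace of the operators $X(a)$, $a\in C_2^\perp$, and $Z(b)$, $b\in C_1^\perp$. Then $\mathcal F\subsetneq C_q(t,m,\ell)$, and the standard CSS code of the pair $C_1=\mathcal F^\perp$, $C_2=C_q(t,m,\ell)$ is an asymmetric quantum code with parameters $$\Big[\Big[\,t+\tfrac{q^2-q}{2},\ \tfrac{m(m-1)}{2}+\ell-7,\ \{d_z,d_x\}\Big]\Big]_q,\qquad d_z\ge\delta,\quad d_x\ge 5,$$ where $d_z$ is the minimum Hamming weight of the words in $C_q(t,m,\ell)\setminus\mathcal F$ and $d_x$ is the minimum Hamming weight of the words in $\mathcal F^\perp\setminus C_q(t,m,\ell)^\perp$. -/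

import Mathlib

open Polynomial

noncomputable section

namespace XingLing

/-! ### Classical linear codes -/

section Classical

variable {F : Type*} [Field F] {ι : Type*} [Fintype ι]

/-- The Euclidean dual of a linear code of length `|ι|` over `F`. -/
def euclideanDual (C : Submodule F (ι → F)) : Submodule F (ι → F) where
  carrier := {u | ∀ v ∈ C, ∑ i, u i * v i = 0}
  add_mem' := by
    intro a b ha hb v hv
    simp [add_mul, Finset.sum_add_distrib, ha v hv, hb v hv]
  zero_mem' := by
    intro v _
    simp
  smul_mem' := by
    intro c a ha v hv
    simp [mul_assoc, ← Finset.mul_sum, ha v hv]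

/-- `IsWtDiff C D d` says that `d = wt(C \ D)`: the set `C \ D` is non-empty, and `d` is the least
Hamming weight of its elements. -/
def IsWtDiff [DecidableEq F] (C D : Submodule F (ι → F)) (d : ℕ) : Prop :=
  IsLeast (hammingNorm '' ((C : Set (ι → F)) \ (D : Set (ι → F)))) d

end Classical

/-! ### Quantum codes in `(ℂ^q)^{⊗n}` -/

section Quantum

variable (F : Type*) [Field F] [Fintype F] (ι : Type*) [Fintype ι]

/-- The state space `(ℂ^q)^{⊗n}` with `q = |F|`, `n = |ι|`, in coordinates with respect to its
standard orthonormal basis `|u⟩ = ⨂ |u_i⟩`, `u ∈ F^n`. -/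
abbrev StateSpace : Type _ := EuclideanSpace ℂ (ι → F)

variable {F ι}

/-- The canonical additive character `x ↦ exp (2πi Tr(x) / p)` of the finite field `F` of
characteristic `p`, where `Tr` is the absolute trace onto `ℤ/pℤ`. -/
def canonicalChar (x : F) : ℂ :=
  letI : Algebra (ZMod (ringChar F)) F := ZMod.algebra F (ringChar F)
  Complex.exp (2 * Real.pi * Complex.I *
    ((Algebra.trace (ZMod (ringChar F)) F x).val : ℂ) / (ringChar F : ℂ))

/-- The bit-flip operator `X(a) : |u⟩ ↦ |u + a⟩`. -/
def bitFlip (a : ι → F) : StateSpace F ι →ₗ[ℂ] StateSpace F ι where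
  toFun ψ := WithLp.toLp 2 fun u => ψ (u - a)
  map_add' _ _ := by ext; simp
  map_smul' _ _ := by ext; simp

/-- The phase-flip operator `Z(b) : |u⟩ ↦ χ(b · u) |u⟩`. -/
def phaseFlip (b : ι → F) : StateSpace F ι →ₗ[ℂ] StateSpace F ι where
  toFun ψ := WithLp.toLp 2 fun u => canonicalChar (∑ i, b i * u i) * ψ u
  map_add' _ _ := by ext; simp [mul_add]
  map_smul' _ _ := by ext; simp [mul_left_comm]

variable (F ι) in
/-- The group of error operators `c X(a) Z(b)`, with phases `c` on the unit circle. -/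
def errorGroup : Subgroup (StateSpace F ι →ₗ[ℂ] StateSpace F ι)ˣ :=
  Subgroup.closure {g | ∃ (c : ℂ) (a b : ι → F), ‖c‖ = 1 ∧
    (g : StateSpace F ι →ₗ[ℂ] StateSpace F ι) = c • (bitFlip a ∘ₗ phaseFlip b)}

/-- A stabilizer code: the non-zero joint `+1`-eigenspace of an abelian group of error operators. -/
def IsStabilizerCode (Q : Submodule ℂ (StateSpace F ι)) : Prop :=
  Q ≠ ⊥ ∧ ∃ S : Subgroup (StateSpace F ι →ₗ[ℂ] StateSpace F ι)ˣ,
    S ≤ errorGroup F ι ∧ (∀ s ∈ S, ∀ s' ∈ S, s * s' = s' * s) ∧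
    ∀ ψ, ψ ∈ Q ↔ ∀ s ∈ S, (s : StateSpace F ι →ₗ[ℂ] StateSpace F ι) ψ = ψ

/-- `Q` detects the error operator `E` (Knill–Laflamme): `P E P = c P` for a scalar `c`, where `P`
is the orthogonal projection onto `Q`. -/
def Detects [DecidableEq ι] (Q : Submodule ℂ (StateSpace F ι))
    (E : StateSpace F ι →ₗ[ℂ] StateSpace F ι) : Prop :=
  ∃ c : ℂ, ∀ φ ∈ Q, ∀ ψ ∈ Q, inner ℂ φ (E ψ) = c * inner ℂ φ ψ

/-- `Q` is an asymmetric quantum (stabilizer) code with parameters `[[n, k, {dz, dx}]]_q`, where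
`q = |F|`: it is a stabilizer code in `(ℂ^q)^{⊗n}` of dimension `q^k` that detects every
combination of at most `dx - 1` bit-flips and at most `dz - 1` phase-flips. -/
structure IsAQC [DecidableEq F] [DecidableEq ι] (n k dz dx : ℕ) (Q : Submodule ℂ (StateSpace F ι)) : Prop where
  length_eq : Fintype.card ι = n
  dz_pos : 1 ≤ dz
  dx_pos : 1 ≤ dx
  stabilizer : IsStabilizerCode Q
  finrank_eq : Module.finrank ℂ Q = Fintype.card F ^ k
  detects : ∀ a b : ι → F, hammingNorm a ≤ dx - 1 → hammingNorm b ≤ dz - 1 →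
    Detects Q (bitFlip a ∘ₗ phaseFlip b)

/-- The standard CSS code of a pair of linear codes with `C₁^⊥ ⊆ C₂`: the joint `+1`-eigenspace
of the `X(a)` with `a ∈ C₂^⊥` and the `Z(b)` with `b ∈ C₁^⊥`. Equivalently it is spanned by the
coset states `∑_{c ∈ C₂^⊥} |v + c⟩` with `v ∈ C₁`. -/
def cssCode (C₁ C₂ : Submodule F (ι → F)) : Submodule ℂ (StateSpace F ι) where
  carrier := {ψ | (∀ a ∈ euclideanDual C₂, bitFlip a ψ = ψ) ∧
    ∀ b ∈ euclideanDual C₁, phaseFlip b ψ = ψ}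
  add_mem' := by
    intro ψ φ hψ hφ
    exact ⟨fun a ha => by rw [map_add, hψ.1 a ha, hφ.1 a ha],
      fun b hb => by rw [map_add, hψ.2 b hb, hφ.2 b hb]⟩
  zero_mem' := ⟨fun a _ => map_zero _, fun b _ => map_zero _⟩
  smul_mem' := by
    intro c ψ hψ
    exact ⟨fun a ha => by rw [map_smul, hψ.1 a ha], fun b hb => by rw [map_smul, hψ.2 b hb]⟩

end Quantum

/-! ### Xing–Ling codes -/

section XL

/-- `e_{i,j}(x) = x^{iq+j} + x^{jq+i}` for `i ≠ j`, and `e_{i,i}(x) = x^{iq+i}`. -/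
def ePoly (F : Type*) [Field F] (q i j : ℕ) : F[X] :=
  if i = j then X ^ (i * q + j) else X ^ (i * q + j) + X ^ (j * q + i)

/-- `V_{m,ℓ}`, spanned by `e_{i,j}` for `0 ≤ i ≤ j ≤ m - 2` and `e_{i,m-1}` for `0 ≤ i ≤ ℓ`. -/
def VSpace (F : Type*) [Field F] (q m l : ℕ) : Submodule F F[X] :=
  Submodule.span F
    ({f | ∃ i j : ℕ, i ≤ j ∧ j + 2 ≤ m ∧ f = ePoly F q i j} ∪
      {f | ∃ i : ℕ, i ≤ l ∧ f = ePoly F q i (m - 1)})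

/-- The eight-dimensional space `W_8` of polynomials. -/
def W8Space (F : Type*) [Field F] (q : ℕ) : Submodule F F[X] :=
  Submodule.span F
    {1, X ^ (q + 1), X ^ (2 * (q + 1)), X ^ (3 * (q + 1)), X ^ q + X, X ^ (2 * q) + X ^ 2,
      X ^ (3 * q) + X ^ 3, X ^ (2 * q + 1) + X ^ (q + 2)}

variable {F K : Type*} [Field F] [Field K] [Algebra F K]

/-- The evaluation code of a space `V` of polynomials over `F` at points `P i` of the extension
`K`: the words `c` over `F` with `c = (f(P i))_i` for some `f ∈ V`, as an equality in `K`. (For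
the spaces `V_{m,ℓ}` and `W_8`, with `|F| = q` and `|K| = q²`, all values `f(P i)` lie in `F`.) -/
def evalCode {ι : Type*} (V : Submodule F F[X]) (P : ι → K) : Submodule F (ι → F) where
  carrier := {c | ∃ f ∈ V, ∀ i, algebraMap F K (c i) = aeval (P i) f}
  add_mem' := by
    rintro c c' ⟨f, hf, h⟩ ⟨f', hf', h'⟩
    exact ⟨f + f', V.add_mem hf hf', fun i => by simp [h i, h' i]⟩
  zero_mem' := ⟨0, V.zero_mem, fun i => by simp⟩
  smul_mem' := by
    rintro s c ⟨f, hf, h⟩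
    exact ⟨s • f, V.smul_mem s hf, fun i => by simp [h i, Algebra.smul_def]⟩

/-- `α_1, …, α_q, β_1, β_1^q, …, β_r, β_r^q` with `r = (q² - q)/2` lists every element of `K`
exactly once, where the `α_i` lie in the subfield `F`. -/
def IsListing (q : ℕ) (α : Fin q → F) (β : Fin ((q ^ 2 - q) / 2) → K) : Prop :=
  Function.Bijective
    (Sum.elim (fun i => algebraMap F K (α i)) (Sum.elim β (fun j => β j ^ q)))

/-- The evaluation points `(α_1, …, α_t, β_1, …, β_r)`. -/
def evalPoints (q t : ℕ) (ht : t ≤ q) (α : Fin q → F) (β : Fin ((q ^ 2 - q) / 2) → K) :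
    Fin (t + (q ^ 2 - q) / 2) → K :=
  Fin.append (fun i : Fin t => algebraMap F K (α (Fin.castLE ht i))) β

/-- The Xing–Ling code `C_q(t, m, ℓ)`. -/
def xlCode (q t m l : ℕ) (ht : t ≤ q) (α : Fin q → F) (β : Fin ((q ^ 2 - q) / 2) → K) :
    Submodule F (Fin (t + (q ^ 2 - q) / 2) → F) :=
  evalCode (VSpace F q m l) (evalPoints q t ht α β)

/-- The code `𝓕`: the evaluation code of `W_8` at the same points. -/
def subCode (q t : ℕ) (ht : t ≤ q) (α : Fin q → F) (β : Fin ((q ^ 2 - q) / 2) → K) :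
    Submodule F (Fin (t + (q ^ 2 - q) / 2) → F) :=
  evalCode (W8Space F q) (evalPoints q t ht α β)

/-- The quantity `g` in the designed distance. -/
def xlG (q t m l : ℕ) : ℤ :=
  if Even q then
    if l = m - 1 then max (min ((m : ℤ) - 1) t) (2 * t - q)
    else max (min ((m : ℤ) - 2) t) (2 * t - q)
  else min (max (2 * ((m : ℤ) - 2)) (m + l - 1)) t

/-- The designed distance `δ = n - (q(m-1) + ℓ + g)/2`, with `n = t + (q² - q)/2`. -/
def designedDistance (q t m l : ℕ) : ℚ :=
  ((t : ℚ) + ((q : ℚ) ^ 2 - q) / 2) - ((q : ℚ) * (m - 1) + l + xlG q t m l) / 2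

end XL

end XingLing

end

/-! The quantum half is formal. For linear codes D ⊆ C, the CSS code of (D^⊥, C) consists of the
functions supported on D^⊥ and constant on cosets of C^⊥, so its dimension is q^(dim C - dim D)
(`finrank_cssCode`). An error X(a)Z(b) can go undetected only if a ∈ D^⊥ \ C^⊥ or b ∈ C \ D
(`detects_cssCode`).

Dimensions come from base-q digits, which make the e_{i,j} independent, and from the fact that a
nonzero f in V_{m,ℓ} has degree below q² - q, too small to vanish at all β_j and their conjugates.

For d_z, let f have A zeros among the α_i with i ≤ t and B among the β_j. Then A + 2B ≤ deg f, so A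
≤ g gives the bound on A + B. On F, where x^q = x, f agrees with some h(x), or h(x²) in
characteristic two, with h of small degree. If h ≠ 0 this bounds A; if h = 0, all q elements of F
are zeros, double ones for odd q, which leaves less room for B (`two_mul_card_zeros_le`).

For d_x, the trace T and norm N embed the evaluation points in the plane F², and W_8 becomes the
span of 1, T, T², T³, N, N², N³, TN. These functions separate a point from any three others
(`exists_separating`), so no nonzero dual word has weight at most 4. -/

namespace XingLing

/-! ### Duality of linear codes. -/

section Dual

variable {F : Type*} [Field F] {ι : Type*} [Fintype ι]

theorem mem_euclideanDual {C : Submodule F (ι → F)} {u : ι → F} :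
    u ∈ euclideanDual C ↔ ∀ v ∈ C, ∑ i, u i * v i = 0 := Iff.rfl

theorem euclideanDual_eq_orthogonal (C : Submodule F (ι → F)) :
    euclideanDual C = LinearMap.BilinForm.orthogonal (dotProductBilin F F) C := by
  ext u
  rw [mem_euclideanDual, LinearMap.BilinForm.mem_orthogonal_iff]
  refine forall₂_congr fun v _ => ?_
  simp [dotProductBilin, dotProduct, mul_comm]

theorem dotProductBilin_nondegenerate :
    LinearMap.BilinForm.Nondegenerate (dotProductBilin F F : LinearMap.BilinForm F (ι → F)) := by
  classical
  constructor
  · intro v hv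
    ext i
    simpa [dotProductBilin] using hv (Pi.single i 1)
  · intro v hv
    ext i
    simpa [dotProductBilin] using hv (Pi.single i 1)

theorem dotProductBilin_isRefl :
    LinearMap.BilinForm.IsRefl (dotProductBilin F F : LinearMap.BilinForm F (ι → F)) := by
  intro u v h
  simpa [dotProductBilin, dotProduct_comm] using h

theorem euclideanDual_euclideanDual (C : Submodule F (ι → F)) :
    euclideanDual (euclideanDual C) = C := by
  rw [euclideanDual_eq_orthogonal, euclideanDual_eq_orthogonal,
    LinearMap.BilinForm.orthogonal_orthogonal dotProductBilin_nondegenerate dotProductBilin_isRefl]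

theorem finrank_euclideanDual (C : Submodule F (ι → F)) :
    Module.finrank F (euclideanDual C) = Fintype.card ι - Module.finrank F C := by
  rw [euclideanDual_eq_orthogonal,
    LinearMap.BilinForm.finrank_orthogonal dotProductBilin_nondegenerate,
    Module.finrank_fintype_fun_eq_card]

theorem euclideanDual_anti {C D : Submodule F (ι → F)} (h : D ≤ C) :
    euclideanDual C ≤ euclideanDual D := fun _ hu v hv => hu v (h hv)

theorem exists_isWtDiff [DecidableEq F] {C D : Submodule F (ι → F)} (h : D < C) :
    ∃ d, IsWtDiff C D d := by
  obtain ⟨u, hC, hD⟩ := SetLike.exists_of_lt h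
  have hne : (hammingNorm '' ((C : Set (ι → F)) \ (D : Set (ι → F)))).Nonempty :=
    ⟨_, u, ⟨hC, hD⟩, rfl⟩
  exact ⟨_, Nat.sInf_mem hne, fun d hd => Nat.sInf_le hd⟩

theorem euclideanDual_strictAnti {C D : Submodule F (ι → F)} (h : D < C) :
    euclideanDual C < euclideanDual D := by
  refine lt_of_le_of_ne (euclideanDual_anti h.le) fun he => h.ne ?_
  rw [← euclideanDual_euclideanDual D, ← he, euclideanDual_euclideanDual]

end Dual

/-! ### The canonical additive character. -/

section Char

variable {F : Type*} [Field F] [Fintype F]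

theorem canonicalChar_eq_stdAddChar (x : F) :
    letI : Algebra (ZMod (ringChar F)) F := ZMod.algebra F (ringChar F)
    haveI : NeZero (ringChar F) := ⟨CharP.ringChar_ne_zero_of_finite F⟩
    canonicalChar x = ZMod.stdAddChar (Algebra.trace (ZMod (ringChar F)) F x) := by
  let _ : Algebra (ZMod (ringChar F)) F := ZMod.algebra F (ringChar F)
  have : NeZero (ringChar F) := ⟨CharP.ringChar_ne_zero_of_finite F⟩
  have h := ZMod.stdAddChar_coe (N := ringChar F)
    ((Algebra.trace (ZMod (ringChar F)) F x).val : ℤ)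
  rw [Int.cast_natCast, ZMod.natCast_zmod_val] at h
  rw [h, canonicalChar, Int.cast_natCast]

theorem canonicalChar_add (x y : F) :
    canonicalChar (x + y) = canonicalChar x * canonicalChar y := by
  simp only [canonicalChar_eq_stdAddChar, map_add, AddChar.map_add_eq_mul]

@[simp] theorem canonicalChar_zero : canonicalChar (0 : F) = 1 := by
  simp only [canonicalChar_eq_stdAddChar, map_zero, AddChar.map_zero_eq_one]

/-- Nondegeneracy of the trace form, combined with the injectivity of the standard character of
ℤ/pℤ. -/
theorem exists_canonicalChar_mul_ne_one {a : F} (ha : a ≠ 0) :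
    ∃ b : F, canonicalChar (b * a) ≠ 1 := by
  let _ : Algebra (ZMod (ringChar F)) F := ZMod.algebra F (ringChar F)
  have : NeZero (ringChar F) := ⟨CharP.ringChar_ne_zero_of_finite F⟩
  obtain ⟨b, hb⟩ := FiniteField.trace_to_zmod_nondegenerate F ha
  refine ⟨b, fun h => hb ?_⟩
  rw [canonicalChar_eq_stdAddChar, mul_comm] at h
  exact ZMod.injective_stdAddChar (h.trans (AddChar.map_zero_eq_one _).symm)

variable {ι : Type*} [Fintype ι]

/-- A vector that pairs trivially with a linear code under the canonical character is orthogonal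
to the code. -/
theorem mem_euclideanDual_of_canonicalChar {C : Submodule F (ι → F)} {u : ι → F}
    (h : ∀ v ∈ C, canonicalChar (∑ i, v i * u i) = 1) : u ∈ euclideanDual C := by
  intro v hv
  by_contra hne
  obtain ⟨b, hb⟩ := exists_canonicalChar_mul_ne_one hne
  refine hb ?_
  rw [← h (b • v) (C.smul_mem b hv), Finset.mul_sum]
  congr 1
  refine Finset.sum_congr rfl fun i _ => ?_
  simp only [Pi.smul_apply, smul_eq_mul]
  ring

end Char

/-! ### CSS codes: structure, dimension and error detection. -/

section Quantum

variable {F : Type*} [Field F] {ι : Type*}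

@[simp] theorem bitFlip_apply (a : ι → F) (ψ : StateSpace F ι) (u : ι → F) :
    bitFlip a ψ u = ψ (u - a) := rfl

theorem bitFlip_comp (a a' : ι → F) : bitFlip a ∘ₗ bitFlip a' = bitFlip (a + a') := by
  ext ψ u
  simp [sub_sub]

theorem bitFlip_zero : bitFlip (0 : ι → F) = LinearMap.id := by
  ext ψ u
  simp

variable [Fintype ι]

@[simp] theorem phaseFlip_apply (b : ι → F) (ψ : StateSpace F ι) (u : ι → F) :
    phaseFlip b ψ u = canonicalChar (∑ i, b i * u i) * ψ u := rfl

theorem phaseFlip_comp [Fintype F] (b b' : ι → F) :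
    phaseFlip b ∘ₗ phaseFlip b' = phaseFlip (b + b') := by
  ext ψ u
  simp [add_mul, Finset.sum_add_distrib, canonicalChar_add, mul_assoc]

theorem phaseFlip_zero [Fintype F] : phaseFlip (0 : ι → F) = LinearMap.id := by
  ext ψ u
  simp

theorem bitFlip_comp_phaseFlip_of_orthogonal {a b : ι → F} (h : ∑ i, b i * a i = 0) :
    bitFlip a ∘ₗ phaseFlip b = phaseFlip b ∘ₗ bitFlip a := by
  ext ψ u
  simp [mul_sub, h]

/-- The bit-flip operator as a unit. -/
noncomputable def bitFlipUnit (a : ι → F) : (StateSpace F ι →ₗ[ℂ] StateSpace F ι)ˣ where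
  val := bitFlip a
  inv := bitFlip (-a)
  val_inv := by rw [Module.End.mul_eq_comp, bitFlip_comp, add_neg_cancel, bitFlip_zero]; rfl
  inv_val := by rw [Module.End.mul_eq_comp, bitFlip_comp, neg_add_cancel, bitFlip_zero]; rfl

theorem mem_cssCode {C₁ C₂ : Submodule F (ι → F)} {ψ : StateSpace F ι} :
    ψ ∈ cssCode C₁ C₂ ↔ (∀ a ∈ euclideanDual C₂, bitFlip a ψ = ψ) ∧
      ∀ b ∈ euclideanDual C₁, phaseFlip b ψ = ψ := Iff.rfl

variable [Fintype F]

/-- The phase-flip operator as a unit. -/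
noncomputable def phaseFlipUnit (b : ι → F) : (StateSpace F ι →ₗ[ℂ] StateSpace F ι)ˣ where
  val := phaseFlip b
  inv := phaseFlip (-b)
  val_inv := by rw [Module.End.mul_eq_comp, phaseFlip_comp, add_neg_cancel, phaseFlip_zero]; rfl
  inv_val := by rw [Module.End.mul_eq_comp, phaseFlip_comp, neg_add_cancel, phaseFlip_zero]; rfl

/-- In coordinates, the CSS code consists of the vectors supported on `D^⊥` that are constant on
the cosets of `C^⊥`. -/
theorem mem_cssCode_dual_iff {C D : Submodule F (ι → F)} {ψ : StateSpace F ι} :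
    ψ ∈ cssCode (euclideanDual D) C ↔
      (∀ a ∈ euclideanDual C, ∀ u, ψ (u - a) = ψ u) ∧ ∀ u, u ∉ euclideanDual D → ψ u = 0 := by
  rw [mem_cssCode, euclideanDual_euclideanDual]
  refine and_congr (forall₂_congr fun a _ => ?_) ⟨fun h u hu => ?_, fun h b hb => ?_⟩
  · exact ⟨fun h u => by rw [← bitFlip_apply, h], fun h => by ext u; exact h u⟩
  · by_contra hψ
    refine hu (mem_euclideanDual_of_canonicalChar fun v hv => ?_)
    have := congrArg (fun φ : StateSpace F ι => φ u) (h v hv)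
    simpa [hψ] using this
  · ext u
    by_cases hu : u ∈ euclideanDual D
    · have : ∑ i, b i * u i = 0 := by
        rw [← hu b hb]
        exact Finset.sum_congr rfl fun i _ => mul_comm _ _
      simp [this]
    · simp [h u hu]

/-- The inclusion makes C₂^⊥ orthogonal to C₁^⊥, so the generating shifts and phases commute; a
vector fixed by the generators is fixed by the group they generate. -/
theorem isStabilizerCode_cssCode {C₁ C₂ : Submodule F (ι → F)} (h : euclideanDual C₁ ≤ C₂)
    (hne : cssCode C₁ C₂ ≠ ⊥) : IsStabilizerCode (cssCode C₁ C₂) := by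
  let G : Set (StateSpace F ι →ₗ[ℂ] StateSpace F ι)ˣ :=
    {g | (∃ a ∈ euclideanDual C₂, g = bitFlipUnit a) ∨
      ∃ b ∈ euclideanDual C₁, g = phaseFlipUnit b}
  have hXZ : ∀ a ∈ euclideanDual C₂, ∀ b ∈ euclideanDual C₁,
      bitFlipUnit a * phaseFlipUnit b = phaseFlipUnit b * bitFlipUnit a := by
    intro a ha b hb
    refine Units.ext (bitFlip_comp_phaseFlip_of_orthogonal ?_)
    rw [← ha b (h hb)]
    exact Finset.sum_congr rfl fun i _ => mul_comm _ _
  have hG : ∀ x ∈ G, ∀ y ∈ G, x * y = y * x := by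
    rintro x (⟨a, ha, rfl⟩ | ⟨b, hb, rfl⟩) y (⟨a', ha', rfl⟩ | ⟨b', hb', rfl⟩)
    · exact Units.ext ((bitFlip_comp a a').trans (by rw [add_comm, ← bitFlip_comp]; rfl))
    · exact hXZ a ha b' hb'
    · exact (hXZ a' ha' b hb).symm
    · exact Units.ext ((phaseFlip_comp b b').trans (by rw [add_comm, ← phaseFlip_comp]; rfl))
  refine ⟨hne, Subgroup.closure G, ?_, ?_, fun ψ => ⟨fun hψ s hs => ?_, fun hψ => ⟨?_, ?_⟩⟩⟩
  · refine (Subgroup.closure_le _).2 ?_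
    rintro g (⟨a, -, rfl⟩ | ⟨b, -, rfl⟩)
    · exact Subgroup.subset_closure ⟨1, a, 0, by simp, by simp [phaseFlip_zero, bitFlipUnit]⟩
    · exact Subgroup.subset_closure ⟨1, 0, b, by simp, by simp [bitFlip_zero, phaseFlipUnit]⟩
  · intro s hs s' hs'
    have hc := Subgroup.isMulCommutative_closure hG
    exact congrArg Subtype.val (mul_comm' (⟨s, hs⟩ : Subgroup.closure G) ⟨s', hs'⟩)
  · induction hs using Subgroup.closure_induction with
    | mem x hx =>
      obtain ⟨a, ha, rfl⟩ | ⟨b, hb, rfl⟩ := hx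
      · exact hψ.1 a ha
      · exact hψ.2 b hb
    | one => rfl
    | mul x y _ _ hx hy =>
      rw [Units.val_mul, Module.End.mul_apply, hy, hx]
    | inv x _ hx =>
      conv_lhs => rw [← hx]
      rw [← Module.End.mul_apply, Units.inv_mul, Module.End.one_apply]
  · exact fun a ha => hψ _ (Subgroup.subset_closure (Or.inl ⟨a, ha, rfl⟩))
  · exact fun b hb => hψ _ (Subgroup.subset_closure (Or.inr ⟨b, hb, rfl⟩))

/-- Extension by zero identifies the code with the space of all complex functions on D^⊥ / C^⊥, so
its dimension is the size of that quotient. -/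
theorem finrank_cssCode {C D : Submodule F (ι → F)} (h : D ≤ C) :
    Module.finrank ℂ (cssCode (euclideanDual D) C) =
      Fintype.card F ^ (Module.finrank F C - Module.finrank F D) := by
  classical
  set A := euclideanDual D with hA
  set N := (euclideanDual C).submoduleOf A with hN
  have hle : euclideanDual C ≤ A := euclideanDual_anti h
  let f : ((A ⧸ N) → ℂ) →ₗ[ℂ] StateSpace F ι :=
    { toFun := fun g => WithLp.toLp 2 fun u =>
        if hu : u ∈ A then g (Submodule.Quotient.mk ⟨u, hu⟩) else 0
      map_add' := fun g g' => by
        ext u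
        by_cases hu : u ∈ A <;> simp [hu]
      map_smul' := fun c g => by
        ext u
        by_cases hu : u ∈ A <;> simp [hu] }
  have hf : ∀ g u, f g u = if hu : u ∈ A then g (Submodule.Quotient.mk ⟨u, hu⟩) else 0 :=
    fun _ _ => rfl
  have hinj : Function.Injective f := by
    intro g g' hgg
    ext x
    obtain ⟨⟨u, hu⟩, rfl⟩ := Submodule.Quotient.mk_surjective N x
    have := congrArg (fun φ : StateSpace F ι => φ u) hgg
    simpa [hf, hu] using this
  have hrange : LinearMap.range f = cssCode A C := by
    ext ψ
    refine Iff.trans ?_ (mem_cssCode_dual_iff (C := C) (D := D)).symm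
    rw [← hA]
    constructor
    · rintro ⟨g, rfl⟩
      refine ⟨fun a ha u => ?_, fun u hu => by rw [hf, dif_neg hu]⟩
      rw [hf, hf]
      by_cases hu : u ∈ A
      · have hua : u - a ∈ A := A.sub_mem hu (hle ha)
        rw [dif_pos hu, dif_pos hua]
        congr 1
        rw [Submodule.Quotient.eq]
        simpa [hN, Submodule.submoduleOf] using ha
      · have hua : u - a ∉ A := fun hua => hu (by simpa using A.add_mem hua (hle ha))
        rw [dif_neg hu, dif_neg hua]
    · rintro ⟨h1, h2⟩
      refine ⟨fun x => ψ (Quotient.out x : A).1, ?_⟩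
      ext u
      rw [hf]
      by_cases hu : u ∈ A
      · rw [dif_pos hu]
        set w : A := Quotient.out (Submodule.Quotient.mk (p := N) ⟨u, hu⟩) with hw
        have hwu : (Submodule.Quotient.mk w : A ⧸ N) = Submodule.Quotient.mk ⟨u, hu⟩ :=
          Quotient.out_eq _
        rw [Submodule.Quotient.eq] at hwu
        have hmem : w.1 - u ∈ euclideanDual C := by
          simpa [hN, Submodule.submoduleOf] using hwu
        rw [← h1 _ hmem w.1, sub_sub_cancel]
      · rw [dif_neg hu, h2 u hu]
  have : Fintype (A ⧸ N) := Fintype.ofFinite _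
  rw [← hrange, LinearMap.finrank_range_of_inj hinj, Module.finrank_fintype_fun_eq_card,
    Module.card_eq_pow_finrank (K := F) (V := A ⧸ N)]
  congr 1
  have h1 := Submodule.finrank_quotient_add_finrank N
  have h2 : Module.finrank F N = Module.finrank F (euclideanDual C) :=
    (Submodule.submoduleOfEquivOfLe hle).finrank_eq
  have h3 := Submodule.finrank_le C
  have h4 := Submodule.finrank_mono h
  rw [Module.finrank_fintype_fun_eq_card] at h3
  have h5 : Module.finrank F A = _ := finrank_euclideanDual D
  rw [h2, finrank_euclideanDual, h5] at h1
  omega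

/-- The CSS code of a pair of nested linear codes detects all errors whose bit-flip part is lighter
than `D^⊥ \ C^⊥` and whose phase-flip part is lighter than `C \ D`. -/
theorem detects_cssCode [DecidableEq ι] {C D : Submodule F (ι → F)} {a b : ι → F}
    (ha : a ∈ euclideanDual D → a ∈ euclideanDual C) (hb : b ∈ C → b ∈ D) :
    Detects (cssCode (euclideanDual D) C) (bitFlip a ∘ₗ phaseFlip b) := by
  by_cases haD : a ∈ euclideanDual D
  swap
  -- The shift by a moves the support D^⊥ to a disjoint coset, so the image is orthogonal to the
  -- code.
  · refine ⟨0, fun φ hφ ψ hψ => ?_⟩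
    rw [mem_cssCode_dual_iff] at hφ hψ
    rw [zero_mul, PiLp.inner_apply]
    refine Finset.sum_eq_zero fun u _ => ?_
    by_cases hu : u ∈ euclideanDual D
    · have hua : u - a ∉ euclideanDual D := fun hua =>
        haD (by simpa using (euclideanDual D).sub_mem hu hua)
      simp [hψ.2 _ hua]
    · simp [hφ.2 _ hu]
  have haC := ha haD
  -- As a ∈ C^⊥, the shift can be moved onto φ, which it fixes; only the phase part matters from
  -- here on.
  have key : ∀ φ ∈ cssCode (euclideanDual D) C, ∀ ψ : StateSpace F ι,
      inner ℂ φ ((bitFlip a ∘ₗ phaseFlip b) ψ) = inner ℂ φ (phaseFlip b ψ) := by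
    intro φ hφ ψ
    rw [mem_cssCode_dual_iff] at hφ
    rw [PiLp.inner_apply, PiLp.inner_apply]
    conv_rhs => rw [← (Equiv.subRight a).sum_comp]
    refine Finset.sum_congr rfl fun u _ => ?_
    simp [hφ.1 a haC]
  by_cases hbC : b ∈ C
  · refine ⟨1, fun φ hφ ψ hψ => ?_⟩
    rw [key φ hφ, hψ.2 b (by rw [euclideanDual_euclideanDual]; exact hb hbC), one_mul]
  · refine ⟨0, fun φ hφ ψ hψ => ?_⟩
    rw [key φ hφ, zero_mul]
    rw [← euclideanDual_euclideanDual C] at hbC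
    obtain ⟨a', ha', hne⟩ : ∃ v ∈ euclideanDual C, canonicalChar (∑ i, v i * b i) ≠ 1 := by
      by_contra! hcon
      exact hbC (mem_euclideanDual_of_canonicalChar hcon)
    rw [mem_cssCode_dual_iff] at hφ hψ
    -- Translating the summation variable by a' ∈ C^⊥ leaves φ and ψ unchanged but multiplies the
    -- sum by a character value other than 1, so the inner product vanishes.
    have hS : (inner ℂ φ (phaseFlip b ψ) : ℂ) =
        canonicalChar (∑ i, a' i * b i) * inner ℂ φ (phaseFlip b ψ) := by
      rw [PiLp.inner_apply, Finset.mul_sum]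
      conv_rhs => rw [← (Equiv.subRight a').sum_comp]
      refine Finset.sum_congr rfl fun u _ => ?_
      have hsum : ∑ i, b i * u i = ∑ i, a' i * b i + ∑ i, b i * (u - a') i := by
        rw [← Finset.sum_add_distrib]
        exact Finset.sum_congr rfl fun i _ => by simp only [Pi.sub_apply]; ring
      simp only [Equiv.subRight_apply, phaseFlip_apply, hφ.1 a' ha', hψ.1 a' ha']
      rw [hsum, canonicalChar_add]
      simp only [RCLike.inner_apply]
      ring
    have : (1 - canonicalChar (∑ i, a' i * b i)) * inner ℂ φ (phaseFlip b ψ) = 0 := by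
      rw [sub_mul, one_mul, ← hS, sub_self]
    exact (mul_eq_zero.1 this).resolve_left (sub_ne_zero.2 (Ne.symm hne))

/-- Parameters of the standard CSS code of a pair `D ≤ C` of linear codes. -/
theorem isAQC_cssCode [DecidableEq F] [DecidableEq ι] {C D : Submodule F (ι → F)} (h : D ≤ C)
    {dz dx : ℕ} (hdz : IsWtDiff C D dz)
    (hdx : IsWtDiff (euclideanDual D) (euclideanDual C) dx) :
    IsAQC (Fintype.card ι) (Module.finrank F C - Module.finrank F D) dz dx
      (cssCode (euclideanDual D) C) := by
  -- Positivity ensures that `d - 1` is not truncated.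
  have pos : ∀ {A B : Submodule F (ι → F)} {d : ℕ}, IsWtDiff A B d → 1 ≤ d := by
    rintro A B d ⟨⟨u, ⟨-, hu⟩, rfl⟩, -⟩
    refine hammingNorm_pos_iff.2 fun h0 => hu ?_
    rw [h0]
    exact B.zero_mem
  have light : ∀ {A B : Submodule F (ι → F)} {d : ℕ}, IsWtDiff A B d → ∀ u : ι → F,
      hammingNorm u ≤ d - 1 → u ∈ A → u ∈ B := by
    intro A B d hd u hu huA
    by_contra huB
    have h1 := hd.2 ⟨u, ⟨huA, huB⟩, rfl⟩
    have h2 := pos hd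
    omega
  refine ⟨rfl, pos hdz, pos hdx, isStabilizerCode_cssCode ?_ ?_, finrank_cssCode h, ?_⟩
  · rwa [euclideanDual_euclideanDual]
  · intro hbot
    have := finrank_cssCode h
    rw [hbot, finrank_bot] at this
    exact (pow_pos (Fintype.card_pos (α := F)) _).ne this
  · exact fun a b ha hb => detects_cssCode (light hdx a ha) (light hdz b hb)

end Quantum

/-! ### The polynomial spaces V_{m,ℓ} and W_8: bases and degrees. -/

section Polys

variable {F : Type*} [Field F] {q : ℕ}

theorem mul_add_inj {i j a b : ℕ} (hj : j < q) (hb : b < q) (h : i * q + j = a * q + b) :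
    i = a ∧ j = b := by
  have hjb : j = b := by
    have := congrArg (· % q) h
    simpa [Nat.add_mod, Nat.mod_eq_of_lt hj, Nat.mod_eq_of_lt hb] using this
  subst hjb
  exact ⟨Nat.eq_of_mul_eq_mul_right (by omega) (Nat.add_right_cancel h), rfl⟩

/-- Base-q digits are unique, and the conjugate exponent jq + i has its digits in the opposite
order. Hence these coefficients form a dual family to the e_{i,j}, which gives linear independence.
-/
theorem coeff_ePoly {i j a b : ℕ} (hij : i ≤ j) (hj : j < q) (hab : a ≤ b) (hb : b < q) :
    (ePoly F q i j).coeff (a * q + b) = if i = a ∧ j = b then 1 else 0 := by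
  have h1 : a * q + b = i * q + j ↔ i = a ∧ j = b :=
    ⟨fun h => mul_add_inj hj hb h.symm, by rintro ⟨rfl, rfl⟩; rfl⟩
  have h2 : a * q + b = j * q + i ↔ i = b ∧ j = a :=
    ⟨fun h => (mul_add_inj (by omega) hb h.symm).symm, by rintro ⟨rfl, rfl⟩; rfl⟩
  unfold ePoly
  split_ifs with h h' h'
  · rw [coeff_X_pow, if_pos (h1.2 h')]
  · rw [coeff_X_pow, if_neg fun hc => h' (h1.1 hc)]
  · rw [coeff_add, coeff_X_pow, coeff_X_pow, if_pos (h1.2 h'), if_neg, add_zero]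
    rw [h2]
    omega
  · rw [coeff_add, coeff_X_pow, coeff_X_pow, if_neg fun hc => h' (h1.1 hc), if_neg, add_zero]
    rw [h2]
    omega

theorem linearIndependent_ePoly (S : Set (ℕ × ℕ)) (hS : ∀ p ∈ S, p.1 ≤ p.2 ∧ p.2 < q) :
    LinearIndependent F fun p : S => ePoly F q p.1.1 p.1.2 := by
  rw [linearIndependent_iff']
  intro s g hg p hp
  have hc := congrArg (fun f : F[X] => f.coeff (p.1.1 * q + p.1.2)) hg
  simp only [finsetSum_coeff, coeff_smul, smul_eq_mul, coeff_zero] at hc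
  rw [Finset.sum_eq_single p] at hc
  · simpa [coeff_ePoly (F := F) (hS p p.2).1 (hS p p.2).2 (hS p p.2).1 (hS p p.2).2] using hc
  · intro x _ hx
    rw [coeff_ePoly (hS x x.2).1 (hS x x.2).2 (hS p p.2).1 (hS p p.2).2, if_neg, mul_zero]
    rintro ⟨h1, h2⟩
    exact hx (Subtype.ext (Prod.ext h1 h2))
  · exact fun h => absurd hp h

theorem finrank_span_ePoly (S : Finset (ℕ × ℕ)) (hS : ∀ p ∈ S, p.1 ≤ p.2 ∧ p.2 < q) :
    Module.finrank F (Submodule.span F ((fun p : ℕ × ℕ => ePoly F q p.1 p.2) '' S)) = S.card := by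
  have h := finrank_span_eq_card (linearIndependent_ePoly (F := F) (S : Set (ℕ × ℕ)) hS)
  rw [Set.image_eq_range, h]
  simp

/-- The pairs `(i, j)` such that `e_{i,j}` is one of the generators of `V_{m,ℓ}`. -/
def vIndex (m l : ℕ) : Finset (ℕ × ℕ) :=
  ((Finset.range m).sigma fun j => Finset.range (if j + 1 = m then l + 1 else j + 1)).map
    ⟨fun x : (_ : ℕ) × ℕ => (x.2, x.1), by rintro ⟨a, b⟩ ⟨c, d⟩ h; simp_all⟩

theorem mem_vIndex {m l i j : ℕ} :
    (i, j) ∈ vIndex m l ↔ j < m ∧ i < if j + 1 = m then l + 1 else j + 1 := by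
  simp only [vIndex, Finset.mem_map, Finset.mem_sigma, Finset.mem_range, Sigma.exists]
  constructor
  · rintro ⟨_, _, h, he⟩
    obtain ⟨rfl, rfl⟩ := Prod.mk.inj he
    exact h
  · exact fun h => ⟨j, i, h, rfl⟩

/-- Each column j < m - 1 contributes j + 1 pairs, and the last one l + 1. -/
theorem card_vIndex {m l : ℕ} (hm : 1 ≤ m) : (vIndex m l).card = m * (m - 1) / 2 + l + 1 := by
  obtain ⟨m, rfl⟩ := Nat.exists_eq_add_of_le' hm
  rw [vIndex, Finset.card_map, Finset.card_sigma, Finset.sum_range_succ]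
  simp only [Finset.card_range, if_true, add_tsub_cancel_right]
  rw [Finset.sum_congr rfl (g := fun j => j + 1) (fun j hj => if_neg (by simp at hj; omega))]
  have := Finset.sum_range_succ' (fun j => j) m
  rw [Finset.sum_range_id, add_zero, add_tsub_cancel_right] at this
  omega

theorem VSpace_eq_span {m l : ℕ} (hm : 1 ≤ m) :
    VSpace F q m l =
      Submodule.span F ((fun p : ℕ × ℕ => ePoly F q p.1 p.2) '' (vIndex m l : Set (ℕ × ℕ))) := by
  unfold VSpace
  congr 1
  ext f
  simp only [Set.mem_union, Set.mem_ofPred_eq, Set.mem_image, Finset.mem_coe, Prod.exists,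
    mem_vIndex]
  constructor
  · rintro (⟨i, j, hij, hj, rfl⟩ | ⟨i, hi, rfl⟩)
    · exact ⟨i, j, ⟨by omega, by rw [if_neg (by omega)]; omega⟩, rfl⟩
    · exact ⟨i, m - 1, ⟨by omega, by rw [if_pos (by omega)]; omega⟩, rfl⟩
  · rintro ⟨i, j, ⟨hj, hi⟩, rfl⟩
    split_ifs at hi with h
    · obtain rfl : j = m - 1 := by omega
      exact Or.inr ⟨i, by omega, rfl⟩
    · exact Or.inl ⟨i, j, by omega, by omega, rfl⟩

theorem finrank_VSpace {m l : ℕ} (hm : 1 ≤ m) (hl : l ≤ m - 1) (hq : m ≤ q) :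
    Module.finrank F (VSpace F q m l) = m * (m - 1) / 2 + l + 1 := by
  rw [VSpace_eq_span hm, finrank_span_ePoly, card_vIndex hm]
  rintro ⟨i, j⟩ hp
  rw [mem_vIndex] at hp
  split_ifs at hp <;> dsimp only <;> omega

theorem W8Space_eq_span :
    W8Space F q = Submodule.span F ((fun p : ℕ × ℕ => ePoly F q p.1 p.2) ''
      (({(0, 0), (1, 1), (2, 2), (3, 3), (0, 1), (0, 2), (0, 3), (1, 2)} : Finset (ℕ × ℕ)) :
        Set (ℕ × ℕ))) := by
  unfold W8Space
  congr 1
  simp only [Finset.coe_insert, Finset.coe_singleton, Set.image_insert_eq, Set.image_singleton]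
  simp only [ePoly, if_true, mul_add, mul_one, Nat.reduceEqDiff, if_false, zero_mul, zero_add,
    one_mul, add_zero, pow_zero, pow_one, OfNat.zero_ne_ofNat, zero_ne_one]
  simp only [add_comm]

theorem finrank_W8Space (hq : 4 ≤ q) : Module.finrank F (W8Space F q) = 8 := by
  rw [W8Space_eq_span, finrank_span_ePoly]
  · rfl
  · intro p hp
    simp only [Finset.mem_insert, Finset.mem_singleton] at hp
    rcases hp with rfl | rfl | rfl | rfl | rfl | rfl | rfl | rfl <;> dsimp only <;> omega

theorem W8Space_le_VSpace {m l : ℕ} (hm : 5 ≤ m) : W8Space F q ≤ VSpace F q m l := by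
  rw [W8Space_eq_span]
  refine Submodule.span_mono ?_
  rintro f ⟨p, hp, rfl⟩
  refine Or.inl ⟨p.1, p.2, ?_⟩
  simp only [Finset.mem_coe, Finset.mem_insert, Finset.mem_singleton] at hp
  rcases hp with rfl | rfl | rfl | rfl | rfl | rfl | rfl | rfl <;>
    exact ⟨by norm_num, by omega, rfl⟩

/-- Induction over `V_{m,ℓ}`: a property closed under linear combinations holds as soon as it holds
for the generators `e_{i,j}`. -/
theorem VSpace_induction {m l : ℕ} (hm : 1 ≤ m) (hl : l ≤ m - 1) {p : F[X] → Prop}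
    (gen : ∀ i j, i ≤ j → j + 1 ≤ m → (j + 1 = m → i ≤ l) → p (ePoly F q i j)) (zero : p 0)
    (add : ∀ f g, p f → p g → p (f + g)) (smul : ∀ (c : F) f, p f → p (c • f)) {f : F[X]}
    (hf : f ∈ VSpace F q m l) : p f := by
  unfold VSpace at hf
  induction hf using Submodule.span_induction with
  | mem f hf =>
    obtain ⟨i, j, hij, hj, rfl⟩ | ⟨i, hi, rfl⟩ := hf
    · exact gen i j hij (by omega) (by omega)
    · exact gen i (m - 1) (by omega) (by omega) (by omega)
  | zero => exact zero
  | add f g _ _ hf hg => exact add f g hf hg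
  | smul c f _ hf => exact smul c f hf

theorem natDegree_le_of_mem_VSpace {m l : ℕ} (hm : 1 ≤ m) (hl : l ≤ m - 1) (hq : m ≤ q) {f : F[X]}
    (hf : f ∈ VSpace F q m l) : f.natDegree ≤ (m - 1) * q + l := by
  refine VSpace_induction (p := fun f : F[X] => f.natDegree ≤ (m - 1) * q + l) hm hl ?_ (by simp)
    (fun f g hf hg => natDegree_add_le_of_degree_le hf hg)
    (fun c f hf => (natDegree_smul_le c f).trans hf) hf
  intro i j hij hj hl'
  have h2 : j * q + i ≤ (m - 1) * q + l := by
    by_cases h : j + 1 = m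
    · obtain rfl : j = m - 1 := by omega
      exact Nat.add_le_add_left (hl' h) _
    · have := Nat.mul_le_mul_right q (show j + 1 ≤ m - 1 by omega)
      rw [add_mul, one_mul] at this
      omega
  have h1 : i * q + j ≤ j * q + i := by
    obtain ⟨d, rfl⟩ := Nat.exists_eq_add_of_le hij
    have := Nat.mul_le_mul_left d (show 1 ≤ q by omega)
    rw [add_mul]
    omega
  unfold ePoly
  split_ifs
  · exact (natDegree_X_pow_le _).trans (h1.trans h2)
  · exact natDegree_add_le_of_degree_le ((natDegree_X_pow_le _).trans (h1.trans h2))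
      ((natDegree_X_pow_le _).trans h2)

end Polys

/-! ### Evaluation codes and descent of values to F. -/

section Evaluation

variable {F K : Type*} [Field F] [Field K] [Algebra F K]

theorem evalCode_mono {ι : Type*} {V W : Submodule F F[X]} (h : V ≤ W) (P : ι → K) :
    evalCode V P ≤ evalCode W P := fun _ ⟨f, hf, hc⟩ => ⟨f, h hf, hc⟩

theorem finrank_evalCode {ι : Type*} (V : Submodule F F[X]) (P : ι → K)
    (hval : ∀ f ∈ V, ∀ i, aeval (P i) f ∈ Set.range (algebraMap F K))
    (hinj : ∀ f ∈ V, (∀ i, aeval (P i) f = 0) → f = 0) :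
    Module.finrank F (evalCode V P) = Module.finrank F V := by
  choose! c hc using hval
  let e : V →ₗ[F] evalCode V P :=
    { toFun := fun f => ⟨c f, f, f.2, hc f f.2⟩
      map_add' := fun f g => by
        ext i
        apply (algebraMap F K).injective
        have := hc _ (f + g).2 i
        simp [hc f f.2, hc g g.2] at this ⊢
        exact this
      map_smul' := fun s f => by
        ext i
        apply (algebraMap F K).injective
        have := hc _ (s • f).2 i
        simp [hc f f.2] at this ⊢
        rw [this, Algebra.smul_def] }
  refine (LinearEquiv.ofBijective e ⟨?_, ?_⟩).finrank_eq.symm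
  · rw [← LinearMap.ker_eq_bot, LinearMap.ker_eq_bot']
    intro f hf
    refine Subtype.ext (hinj f f.2 fun i => ?_)
    rw [← hc f f.2 i, show c f = 0 from congrArg Subtype.val hf]
    simp
  · rintro ⟨w, f, hf, hw⟩
    refine ⟨⟨f, hf⟩, Subtype.ext ?_⟩
    ext i
    apply (algebraMap F K).injective
    rw [hw]
    exact hc f hf i

/-- The listing has no repetition, so no β_j or β_j^q is fixed by x ↦ x^q; a fixed element must be
some α_i. -/
theorem IsListing.mem_range_algebraMap [Fintype K] {q : ℕ} (hK : Fintype.card K = q ^ 2)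
    {α : Fin q → F} {β : Fin ((q ^ 2 - q) / 2) → K} (h : IsListing q α β) {x : K}
    (hx : x ^ q = x) : x ∈ Set.range (algebraMap F K) := by
  have hne : ∀ j, β j ^ q ≠ β j := fun j hj => by
    have := h.1 (a₁ := Sum.inr (Sum.inl j)) (a₂ := Sum.inr (Sum.inr j)) hj.symm
    simp at this
  obtain ⟨i | j | j, hs⟩ := h.2 x
  · exact ⟨α i, hs⟩
  · subst hs
    exact absurd hx (hne j)
  · subst hs
    refine absurd ?_ (hne j)
    have : (β j ^ q) ^ q = β j := by rw [← pow_mul, ← sq, ← hK, FiniteField.pow_card]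
    exact hx.symm.trans this

variable [Fintype F] {q : ℕ}

theorem aeval_pow_card (hF : Fintype.card F = q) (f : F[X]) (x : K) :
    aeval (x ^ q) f = aeval x f ^ q := by
  subst hF
  exact aeval_algHom_apply (FiniteField.frobeniusAlgHom F K) x f

/-- Since x^(q²) = x, replacing x by x^q swaps the exponents iq + j and jq + i, so every e_{i,j} is
unchanged. -/
theorem aeval_pow_eq_self_of_mem_VSpace [Fintype K] (hF : Fintype.card F = q)
    (hK : Fintype.card K = q ^ 2) {m l : ℕ} (hm : 1 ≤ m) (hl : l ≤ m - 1) {f : F[X]} (hf : f ∈ VSpace F q m l) (x : K) :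
    aeval x f ^ q = aeval x f := by
  rw [← aeval_pow_card hF]
  have hx : x ^ (q * q) = x := by rw [← sq, ← hK, FiniteField.pow_card]
  have key : ∀ i j, (x ^ q) ^ (i * q + j) = x ^ (j * q + i) := by
    intro i j
    rw [← pow_mul, mul_add, pow_add, show q * (i * q) = q * q * i by ring, pow_mul, hx,
      mul_comm q j, ← pow_add, add_comm]
  refine VSpace_induction (p := fun f : F[X] => aeval (x ^ q) f = aeval x f) hm hl ?_ (by simp)
    (fun f g hf hg => by simp [hf, hg]) (fun c f hf => by simp [hf]) hf
  intro i j _ _ _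
  unfold ePoly
  split_ifs with h
  · rw [aeval_X_pow, aeval_X_pow, key, h]
  · simp only [map_add, aeval_X_pow, key]
    rw [add_comm]

end Evaluation

/-! ### Counting zeros along a listing. -/

section Zeros

theorem sum_count_le_card {M : Type*} [DecidableEq M] (Z : Finset M) (s : Multiset M) :
    ∑ z ∈ Z, s.count z ≤ s.card := by
  rw [← Multiset.sum_count_eq_card (s := Z ∪ s.toFinset) (m := s) (by intro a ha; simp [ha])]
  exact Finset.sum_le_sum_of_subset Finset.subset_union_left

variable {F K : Type*} [Field F] [Field K] [Algebra F K] [Fintype F] {q : ℕ}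

theorem two_mul_half_sq_sub (q : ℕ) : 2 * ((q ^ 2 - q) / 2) = q ^ 2 - q := by
  refine Nat.mul_div_cancel' ?_
  rw [sq, ← Nat.mul_sub_one]
  exact (Nat.even_mul_pred_self q).two_dvd

/-- Zeros of a polynomial over `F` in the quadratic extension, counted along a listing: those in `F`
with a multiplicity at least `e`, those outside `F` in conjugate pairs. -/
theorem IsListing.card_zeros_le (hF : Fintype.card F = q) {α : Fin q → F}
    {β : Fin ((q ^ 2 - q) / 2) → K} (h : IsListing q α β) {f : F[X]} (hf : f ≠ 0) (e : ℕ)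
    (A : Finset (Fin q)) (hA : ∀ i ∈ A, e ≤ f.rootMultiplicity (α i))
    (B : Finset (Fin ((q ^ 2 - q) / 2))) (hB : ∀ j ∈ B, aeval (β j) f = 0) :
    e * A.card + 2 * B.card ≤ f.natDegree := by
  classical
  have hf' : f.map (algebraMap F K) ≠ 0 :=
    (Polynomial.map_ne_zero_iff (algebraMap F K).injective).2 hf
  have key := sum_count_le_card ((A.disjSum (B.disjSum B)).map ⟨_, h.1⟩)
    (f.map (algebraMap F K)).roots
  rw [Finset.sum_map, Finset.sum_disjSum, Finset.sum_disjSum] at key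
  simp only [Function.Embedding.coeFn_mk, Sum.elim_inl, Sum.elim_inr, count_roots] at key
  have h1 : e * A.card ≤ ∑ i ∈ A, (f.map (algebraMap F K)).rootMultiplicity
      (algebraMap F K (α i)) := by
    rw [mul_comm, ← smul_eq_mul]
    refine Finset.card_nsmul_le_sum _ _ _ fun i hi => ?_
    rw [← eq_rootMultiplicity_map (algebraMap F K).injective]
    exact hA i hi
  have hpos : ∀ x : K, aeval x f = 0 → 1 ≤ (f.map (algebraMap F K)).rootMultiplicity x := by
    intro x hx
    rw [Nat.one_le_iff_ne_zero, ← Nat.pos_iff_ne_zero, rootMultiplicity_pos hf', IsRoot,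
      eval_map_algebraMap, hx]
  have h2 : B.card ≤ ∑ j ∈ B, (f.map (algebraMap F K)).rootMultiplicity (β j) := by
    rw [← mul_one B.card, ← smul_eq_mul]
    exact Finset.card_nsmul_le_sum _ _ _ fun j hj => hpos _ (hB j hj)
  have h3 : B.card ≤ ∑ j ∈ B, (f.map (algebraMap F K)).rootMultiplicity (β j ^ q) := by
    rw [← mul_one B.card, ← smul_eq_mul]
    refine Finset.card_nsmul_le_sum _ _ _ fun j hj => hpos _ ?_
    rw [aeval_pow_card hF, hB j hj, zero_pow]
    rw [← hF]
    exact Fintype.card_ne_zero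
  have h4 := (f.map (algebraMap F K)).card_roots'
  rw [natDegree_map] at h4
  omega

/-- The β_j and their conjugates are q² - q distinct zeros, while the degree is at most (q-2)q + q -
2. No α_i is used, so t = 0 is covered. -/
theorem eq_zero_of_mem_VSpace (hF : Fintype.card F = q) {α : Fin q → F}
    {β : Fin ((q ^ 2 - q) / 2) → K} (h : IsListing q α β) {m l : ℕ} (hm : 1 ≤ m)
    (hl : l ≤ m - 1) (hmq : m ≤ q - 1) {f : F[X]} (hf : f ∈ VSpace F q m l)
    (h0 : ∀ j, aeval (β j) f = 0) : f = 0 := by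
  by_contra hne
  have h1 := h.card_zeros_le hF hne 0 ∅ (by simp) Finset.univ fun j _ => h0 j
  have h2 := natDegree_le_of_mem_VSpace hm hl (by omega) hf
  rw [Finset.card_univ, Fintype.card_fin, two_mul_half_sq_sub, sq, ← Nat.mul_sub_one] at h1
  obtain ⟨d, rfl⟩ : ∃ d, q = d + 2 := ⟨q - 2, by omega⟩
  have h3 : (m - 1) * (d + 2) ≤ d * (d + 2) := Nat.mul_le_mul_right _ (by omega)
  rw [show (d + 2) * (d + 2 - 1) = d * (d + 2) + (d + 2) by
    rw [show d + 2 - 1 = d + 1 by omega]; ring] at h1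
  omega

end Zeros

/-! ### Restriction of V_{m,ℓ} to F. -/

section Restriction

variable {F : Type*} [Field F] [Fintype F] {q : ℕ}

theorem pow_mul_card_add (hF : Fintype.card F = q) (x : F) (i j : ℕ) :
    x ^ (i * q + j) = x ^ (i + j) := by
  rw [pow_add, mul_comm i, pow_mul, ← hF, FiniteField.pow_card, pow_add]

theorem eval_derivative_X_pow_mul_card_add (hF : Fintype.card F = q) (x : F) (i j : ℕ) :
    (derivative (X ^ (i * q + j) : F[X])).eval x = j * x ^ (i + j - 1) := by
  have hq : (q : F) = 0 := by rw [← hF, Nat.cast_card_eq_zero]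
  rw [derivative_X_pow, eval_mul, eval_C, eval_pow, eval_X]
  cases j with
  | zero => simp [hq]
  | succ j =>
    rw [show i * q + (j + 1) - 1 = i * q + j by omega, pow_mul_card_add hF]
    simp [hq, ← add_assoc]

/-- On `F`, a member `f` of `V_{m,ℓ}` agrees with a polynomial `h` of small degree, and `2f'` agrees
with `h'`. -/
theorem exists_restriction (hF : Fintype.card F = q) {m l : ℕ} (hm : 1 ≤ m) (hl : l ≤ m - 1)
    {f : F[X]} (hf : f ∈ VSpace F q m l) :
    ∃ h : F[X], h.natDegree ≤ max (2 * (m - 2)) (m + l - 1) ∧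
      ∀ x, f.eval x = h.eval x ∧ 2 * (derivative f).eval x = (derivative h).eval x := by
  -- Write f(x) = G(x^q, x) with G symmetric and take h(x) = G(x, x). As q = 0 in F, f' sees only
  -- the second partial derivative, whereas h' is the sum of both, which are equal on the diagonal.
  refine VSpace_induction (p := fun f : F[X] => ∃ h : F[X],
    h.natDegree ≤ max (2 * (m - 2)) (m + l - 1) ∧
      ∀ x, f.eval x = h.eval x ∧ 2 * (derivative f).eval x = (derivative h).eval x)
    hm hl ?_ ⟨0, by simp⟩ ?_ ?_ hf
  · intro i j hij hj hil
    have hdeg : i + j ≤ max (2 * (m - 2)) (m + l - 1) := by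
      by_cases h : j + 1 = m
      · have := hil h
        exact le_max_of_le_right (by omega)
      · exact le_max_of_le_left (by omega)
    unfold ePoly
    split_ifs with h
    · subst h
      refine ⟨X ^ (i + i), (natDegree_X_pow_le _).trans hdeg, fun x => ⟨?_, ?_⟩⟩
      · rw [eval_pow, eval_pow, eval_X, pow_mul_card_add hF]
      · rw [eval_derivative_X_pow_mul_card_add hF, derivative_X_pow]
        simp only [eval_mul, eval_C, eval_pow, eval_X, Nat.cast_add]
        ring
    · refine ⟨C 2 * X ^ (i + j), (natDegree_C_mul_X_pow_le _ _).trans hdeg, fun x => ⟨?_, ?_⟩⟩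
      · simp only [eval_add, eval_pow, eval_X, eval_mul, eval_C, pow_mul_card_add hF]
        rw [add_comm j]
        ring
      · rw [derivative_add, eval_add, eval_derivative_X_pow_mul_card_add hF,
          eval_derivative_X_pow_mul_card_add hF, derivative_C_mul, derivative_X_pow, add_comm j]
        simp only [eval_mul, eval_C, eval_pow, eval_X, Nat.cast_add]
        ring
  · rintro f g ⟨h, hd, h1⟩ ⟨k, kd, k1⟩
    refine ⟨h + k, natDegree_add_le_of_degree_le hd kd, fun x => ⟨?_, ?_⟩⟩
    · rw [eval_add, eval_add, (h1 x).1, (k1 x).1]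
    · rw [derivative_add, derivative_add, eval_add, eval_add, mul_add, (h1 x).2, (k1 x).2]
  · rintro c f ⟨h, hd, h1⟩
    refine ⟨c • h, (natDegree_smul_le c h).trans hd, fun x => ⟨?_, ?_⟩⟩
    · rw [eval_smul, eval_smul, (h1 x).1]
    · rw [derivative_smul, derivative_smul, eval_smul, eval_smul, ← (h1 x).2, mul_smul_comm]

/-- In characteristic two, a member of `V_{m,ℓ}` agrees on `F` with a polynomial of small degree in
`x²`. -/
theorem exists_restriction_of_char_two (hF : Fintype.card F = q) (h2 : (2 : F) = 0) {m l : ℕ}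
    (hm : 1 ≤ m) (hl : l ≤ m - 1) {f : F[X]} (hf : f ∈ VSpace F q m l) :
    ∃ h : F[X], h.natDegree ≤ (if l = m - 1 then m - 1 else m - 2) ∧
      ∀ x, f.eval x = h.eval (x ^ 2) := by
  refine VSpace_induction (p := fun f : F[X] => ∃ h : F[X],
    h.natDegree ≤ (if l = m - 1 then m - 1 else m - 2) ∧ ∀ x, f.eval x = h.eval (x ^ 2))
    hm hl ?_ ⟨0, by simp⟩ ?_ ?_ hf
  · intro i j hij hj hil
    have hdeg : i = j → i ≤ (if l = m - 1 then m - 1 else m - 2) := by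
      intro h
      split_ifs <;> omega
    unfold ePoly
    by_cases h : i = j
    · rw [if_pos h]
      refine ⟨X ^ i, (natDegree_X_pow_le _).trans (hdeg h), fun x => ?_⟩
      simp only [eval_pow, eval_X, pow_mul_card_add hF]
      rw [← h, ← pow_mul, two_mul]
    · rw [if_neg h]
      -- Off-diagonal generators restrict to 2x^(i+j) = 0; only the even powers x^(2i) survive.
      refine ⟨0, by simp, fun x => ?_⟩
      simp only [eval_add, eval_pow, eval_X, eval_zero, pow_mul_card_add hF]
      rw [add_comm j, ← two_mul, h2, zero_mul]
  · rintro f g ⟨h, hd, h1⟩ ⟨k, kd, k1⟩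
    exact ⟨h + k, natDegree_add_le_of_degree_le hd kd, fun x => by
      rw [eval_add, eval_add, h1, k1]⟩
  · rintro c f ⟨h, hd, h1⟩
    exact ⟨c • h, (natDegree_smul_le c h).trans hd, fun x => by rw [eval_smul, eval_smul, h1]⟩

end Restriction

/-! ### The designed distance. -/

section Distance

variable {F K : Type*} [Field F] [Field K] [Algebra F K]

theorem IsListing.injective {q : ℕ} {α : Fin q → F} {β : Fin ((q ^ 2 - q) / 2) → K}
    (h : IsListing q α β) : Function.Injective α := fun i j hij => by
  have := h.1 (a₁ := Sum.inl i) (a₂ := Sum.inl j) (by simp [hij])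
  simpa using this

theorem card_le_natDegree_of_eval_eq_zero {ι : Type*} {h : F[X]} (hh : h ≠ 0) {g : ι → F}
    (hg : Function.Injective g) (A : Finset ι) (hA : ∀ i ∈ A, h.eval (g i) = 0) :
    A.card ≤ h.natDegree := by
  rw [← Finset.card_map ⟨g, hg⟩]
  refine card_le_degree_of_subset_roots fun x hx => ?_
  simp only [Finset.mem_val, Finset.mem_map, Function.Embedding.coeFn_mk] at hx
  obtain ⟨i, hi, rfl⟩ := hx
  rw [mem_roots hh]
  exact hA i hi

variable [Fintype F] {q t m l : ℕ}

theorem two_mul_card_zeros_le (hF : Fintype.card F = q) {α : Fin q → F}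
    {β : Fin ((q ^ 2 - q) / 2) → K} (hαβ : IsListing q α β) (ht : t ≤ q) (hm : 2 ≤ m)
    (hmq : m ≤ q) (hl : l ≤ m - 1) {f : F[X]} (hf : f ∈ VSpace F q m l) (hf0 : f ≠ 0)
    (A : Finset (Fin q)) (hA : ∀ i ∈ A, i.1 < t ∧ f.eval (α i) = 0)
    (B : Finset (Fin ((q ^ 2 - q) / 2))) (hB : ∀ j ∈ B, aeval (β j) f = 0) :
    2 * ((A.card : ℤ) + B.card) ≤ q * (m - 1) + l + xlG q t m l := by
  have hdeg : (f.natDegree : ℤ) ≤ q * (m - 1) + l := by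
    have := natDegree_le_of_mem_VSpace (by omega) hl hmq hf
    zify [show 1 ≤ m by omega] at this
    linarith
  have hroot : ∀ i, f.eval (α i) = 0 → 1 ≤ f.rootMultiplicity (α i) := fun i hi =>
    (rootMultiplicity_pos hf0).2 hi
  have hAt : A.card ≤ t := by
    rw [← Finset.card_range t]
    exact Finset.card_le_card_of_injOn Fin.val (fun i hi => by simpa using (hA i hi).1)
      Fin.val_injective.injOn
  -- Add |A| ≤ g to |A| + 2|B| ≤ deg f.
  have few : (A.card : ℤ) ≤ xlG q t m l →
      2 * ((A.card : ℤ) + B.card) ≤ q * (m - 1) + l + xlG q t m l := by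
    intro h
    have := hαβ.card_zeros_le hF hf0 1 A (fun i hi => hroot i (hA i hi).2) B hB
    zify at this
    linarith
  by_cases hq : Even q
  · have h2 : (2 : F) = 0 := by
      have : ringChar F = 2 :=
        FiniteField.even_card_iff_char_two.2 (by rw [hF]; exact Nat.even_iff.1 hq)
      have := ringChar.Nat.cast_ringChar (R := F)
      simp_all
    obtain ⟨h, hd, hev⟩ := exists_restriction_of_char_two hF h2 (by omega) hl hf
    by_cases hh : h = 0
    -- All of F consists of zeros, so q + 2|B| ≤ deg f; with |A| ≤ t this accounts for the term 2t -
    -- q in g.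
    · have := hαβ.card_zeros_le hF hf0 1 Finset.univ
        (fun i _ => hroot i (by rw [hev, hh, eval_zero])) B hB
      rw [Finset.card_univ, Fintype.card_fin] at this
      have hg : 2 * (t : ℤ) - q ≤ xlG q t m l := by
        unfold xlG
        rw [if_pos hq]
        split_ifs <;> exact le_max_right _ _
      zify at this hAt
      linarith
    · refine few ?_
      have hinj : Function.Injective fun i => α i ^ 2 := by
        intro i j hij
        refine hαβ.injective (sub_eq_zero.1 (pow_eq_zero_iff two_ne_zero |>.1 ?_))
        have hij : α i ^ 2 = α j ^ 2 := hij
        linear_combination hij + (α j ^ 2 - α i * α j) * h2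
      have := card_le_natDegree_of_eval_eq_zero hh hinj A fun i hi => by
        rw [← hev]; exact (hA i hi).2
      unfold xlG
      rw [if_pos hq]
      split_ifs at hd ⊢ <;> refine le_max_of_le_left (le_min ?_ ?_) <;> omega
  · have h2 : (2 : F) ≠ 0 := by
      refine Ring.two_ne_zero fun h => hq ?_
      rw [← hF]
      exact Nat.even_iff.2 (FiniteField.even_card_iff_char_two.1 h)
    obtain ⟨h, hd, hev⟩ := exists_restriction hF (by omega) hl hf
    by_cases hh : h = 0
    -- Here 2f' = h' = 0 on F, so all its q elements are double zeros: 2q + 2|B| ≤ deg f, and |A| ≤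
    -- t ≤ q, g ≥ 0 suffice.
    · have := hαβ.card_zeros_le hF hf0 2 Finset.univ (fun i _ => by
        refine (one_lt_rootMultiplicity_iff_isRoot hf0).2 ⟨?_, ?_⟩
        · rw [IsRoot, (hev _).1, hh, eval_zero]
        · have := (hev (α i)).2
          rw [hh, derivative_zero, eval_zero] at this
          exact (mul_eq_zero.1 this).resolve_left h2) B hB
      rw [Finset.card_univ, Fintype.card_fin] at this
      have hg : 0 ≤ xlG q t m l := by
        unfold xlG
        rw [if_neg hq]
        exact le_min (le_max_of_le_left (by omega)) (by omega)
      zify at this hAt ht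
      linarith
    · refine few ?_
      have := card_le_natDegree_of_eval_eq_zero hh hαβ.injective A fun i hi => by
        rw [← (hev _).1]; exact (hA i hi).2
      unfold xlG
      rw [if_neg hq]
      omega

/-- The minimum distance of the Xing–Ling code is at least the designed distance. -/
theorem designedDistance_le_hammingNorm [DecidableEq F] (hF : Fintype.card F = q) {α : Fin q → F}
    {β : Fin ((q ^ 2 - q) / 2) → K} (hαβ : IsListing q α β) (ht : t ≤ q) (hm : 2 ≤ m)
    (hmq : m ≤ q) (hl : l ≤ m - 1) {c : Fin (t + (q ^ 2 - q) / 2) → F}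
    (hc : c ∈ xlCode q t m l ht α β) (hc0 : c ≠ 0) :
    designedDistance q t m l ≤ hammingNorm c := by
  classical
  obtain ⟨f, hf, hev⟩ := hc
  have hf0 : f ≠ 0 := by
    rintro rfl
    refine hc0 (funext fun i => (algebraMap F K).injective ?_)
    simp [hev]
  have hleft : ∀ i : Fin t, c (Fin.castAdd _ i) = f.eval (α (Fin.castLE ht i)) := by
    intro i
    apply (algebraMap F K).injective
    rw [hev, evalPoints, Fin.append_left, aeval_algebraMap_apply_eq_algebraMap_eval]
  have hright : ∀ j, algebraMap F K (c (Fin.natAdd _ j)) = aeval (β j) f := by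
    intro j
    rw [hev, evalPoints, Fin.append_right]
  set A := Finset.univ.filter fun i : Fin q => i.1 < t ∧ f.eval (α i) = 0 with hA
  set B := Finset.univ.filter fun j => aeval (β j) f = 0 with hB
  have hz := two_mul_card_zeros_le hF hαβ ht hm hmq hl hf hf0 A (by simp [hA]) B (by simp [hB])
  have hcard : (Finset.univ.filter fun i => ¬ c i ≠ 0).card ≤ A.card + B.card := by
    rw [← Finset.card_disjSum]
    refine Finset.card_le_card_of_injOn
      (fun i => Sum.map (Fin.castLE ht) id (finSumFinEquiv.symm i)) ?_ ?_
    · intro i hi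
      simp only [Finset.coe_filter, Finset.mem_univ, true_and, ne_eq, not_not,
        Set.mem_ofPred_eq] at hi
      induction i using Fin.addCases with
      | left i => simpa [hA, hleft] using hi
      | right j =>
        have := hright j
        rw [hi, map_zero] at this
        simp [hB, ← this]
    · exact ((Function.Injective.sumMap (Fin.castLE_injective ht) Function.injective_id).comp
        finSumFinEquiv.symm.injective).injOn
  have hsum := Finset.card_filter_add_card_filter_not (s := Finset.univ) fun i => c i ≠ 0
  rw [Finset.card_univ, Fintype.card_fin] at hsum
  have hr := two_mul_half_sq_sub q
  have hqq : q ≤ q ^ 2 := Nat.le_self_pow two_ne_zero q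
  unfold designedDistance
  rw [show hammingNorm c = (Finset.univ.filter fun i => c i ≠ 0).card from rfl]
  have hz' : 2 * ((A.card : ℚ) + B.card) ≤ q * (m - 1) + l + xlG q t m l := by exact_mod_cast hz
  have hr' : 2 * (((q ^ 2 - q) / 2 : ℕ) : ℚ) = (q : ℚ) ^ 2 - q := by
    rw [← Nat.cast_pow, ← Nat.cast_sub hqq]
    exact_mod_cast hr
  have hs' : ((Finset.univ.filter fun i => c i ≠ 0).card : ℚ) +
      (Finset.univ.filter fun i => ¬ c i ≠ 0).card = t + ((q ^ 2 - q) / 2 : ℕ) := by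
    exact_mod_cast hsum
  have hcard' : ((Finset.univ.filter fun i => ¬ c i ≠ 0).card : ℚ) ≤ A.card + B.card := by
    exact_mod_cast hcard
  linarith

end Distance

/-! ### Separating points of the affine plane. -/

section Separation

variable {F : Type*} [Field F]

/-- A space of functions on the affine plane that contains the monomials
`1, x, x², x³, y, y², y³, xy` separates a point from any three others. -/
theorem exists_separating {L : Submodule F (F × F → F)}
    (hL : ∀ c₀ c₁ c₂ c₃ d₁ d₂ d₃ e : F, (fun p : F × F => c₀ + c₁ * p.1 + c₂ * p.1 ^ 2 +
      c₃ * p.1 ^ 3 + d₁ * p.2 + d₂ * p.2 ^ 2 + d₃ * p.2 ^ 3 + e * (p.1 * p.2)) ∈ L)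
    {P Q R S : F × F} (hQ : Q ≠ P) (hR : R ≠ P) (hS : S ≠ P) :
    ∃ φ ∈ L, φ P ≠ 0 ∧ φ Q = 0 ∧ φ R = 0 ∧ φ S = 0 := by
  have conic : ∀ a b c a' b' c' : F,
      (fun p : F × F => (a * p.1 + b * p.2 + c) * (a' * p.1 + b' * p.2 + c')) ∈ L := by
    intro a b c a' b' c'
    convert hL (c * c') (a * c' + a' * c) (a * a') 0 (b * c' + b' * c) (b * b') 0
      (a * b' + a' * b) using 1
    ext p
    ring
  have cubicX : ∀ a b c : F, (fun p : F × F => (p.1 - a) * (p.1 - b) * (p.1 - c)) ∈ L := by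
    intro a b c
    convert hL (-(a * b * c)) (a * b + b * c + a * c) (-(a + b + c)) 1 0 0 0 0 using 1
    ext p
    ring
  have cubicY : ∀ a b c : F, (fun p : F × F => (p.2 - a) * (p.2 - b) * (p.2 - c)) ∈ L := by
    intro a b c
    convert hL (-(a * b * c)) 0 0 0 (a * b + b * c + a * c) (-(a + b + c)) 1 0 using 1
    ext p
    ring
  -- A line through two of the points that misses `P`, together with a line through the third.
  have lines : ∀ {Q R S : F × F}, S ≠ P →
      (Q.1 - P.1) * (R.2 - P.2) ≠ (Q.2 - P.2) * (R.1 - P.1) →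
      ∃ φ ∈ L, φ P ≠ 0 ∧ φ Q = 0 ∧ φ R = 0 ∧ φ S = 0 := by
    intro Q R S hS hne
    -- The equation of the line QR evaluated at P equals the collinearity determinant of P, Q, R.
    have hne' : (Q.2 - R.2) * P.1 + (R.1 - Q.1) * P.2 + (Q.1 * R.2 - Q.2 * R.1) ≠ 0 := fun h =>
      hne (by linear_combination h)
    by_cases h1 : S.1 = P.1
    · have h2 : S.2 ≠ P.2 := fun h => hS (Prod.ext h1 h)
      refine ⟨_, conic (Q.2 - R.2) (R.1 - Q.1) (Q.1 * R.2 - Q.2 * R.1) 0 1 (-S.2),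
        mul_ne_zero hne' fun h => h2 ?_, ?_, ?_, ?_⟩
      · linear_combination -h
      all_goals ring
    · refine ⟨_, conic (Q.2 - R.2) (R.1 - Q.1) (Q.1 * R.2 - Q.2 * R.1) 1 0 (-S.1),
        mul_ne_zero hne' fun h => h1 ?_, ?_, ?_, ?_⟩
      · linear_combination -h
      all_goals ring
  by_cases hQR : (Q.1 - P.1) * (R.2 - P.2) = (Q.2 - P.2) * (R.1 - P.1)
  swap
  · exact lines hS hQR
  by_cases hQS : (Q.1 - P.1) * (S.2 - P.2) = (Q.2 - P.2) * (S.1 - P.1)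
  swap
  · obtain ⟨φ, h, h1, h2, h3, h4⟩ := lines hR hQS
    exact ⟨φ, h, h1, h2, h4, h3⟩
  by_cases hRS : (R.1 - P.1) * (S.2 - P.2) = (R.2 - P.2) * (S.1 - P.1)
  swap
  · obtain ⟨φ, h, h1, h2, h3, h4⟩ := lines hQ hRS
    exact ⟨φ, h, h1, h4, h2, h3⟩
  -- Now all four points lie on one line through P. A cubic in the first coordinate separates them
  -- unless that line is vertical, when a cubic in the second does.
  by_cases hX : Q.1 ≠ P.1 ∧ R.1 ≠ P.1 ∧ S.1 ≠ P.1
  · obtain ⟨h1, h2, h3⟩ := hX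
    refine ⟨_, cubicX Q.1 R.1 S.1, mul_ne_zero (mul_ne_zero ?_ ?_) ?_, by simp, by simp, by simp⟩
    exacts [sub_ne_zero.2 h1.symm, sub_ne_zero.2 h2.symm, sub_ne_zero.2 h3.symm]
  · have vert : ∀ {U V : F × F}, U ≠ P → U.1 = P.1 →
        (U.1 - P.1) * (V.2 - P.2) = (U.2 - P.2) * (V.1 - P.1) → V.1 = P.1 := by
      intro U V hU h1 h
      rw [h1, sub_self, zero_mul, eq_comm, mul_eq_zero] at h
      exact sub_eq_zero.1 (h.resolve_left (sub_ne_zero.2 fun h2 => hU (Prod.ext h1 h2)))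
    have hall : Q.1 = P.1 ∧ R.1 = P.1 ∧ S.1 = P.1 := by
      by_cases h1 : Q.1 = P.1
      · exact ⟨h1, vert hQ h1 hQR, vert hQ h1 hQS⟩
      by_cases h2 : R.1 = P.1
      · exact ⟨vert hR h2 (by linear_combination -hQR), h2, vert hR h2 hRS⟩
      by_cases h3 : S.1 = P.1
      · exact ⟨vert hS h3 (by linear_combination -hQS), vert hS h3 (by linear_combination -hRS), h3⟩
      exact absurd ⟨h1, h2, h3⟩ hX
    have ne2 : ∀ {U : F × F}, U ≠ P → U.1 = P.1 → P.2 - U.2 ≠ 0 := fun hU h1 h =>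
      hU (Prod.ext h1 (sub_eq_zero.1 h).symm)
    exact ⟨_, cubicY Q.2 R.2 S.2, mul_ne_zero (mul_ne_zero (ne2 hQ hall.1) (ne2 hR hall.2.1))
      (ne2 hS hall.2.2), by simp, by simp, by simp⟩

theorem exists_separating_finset {L : Submodule F (F × F → F)}
    (hL : ∀ c₀ c₁ c₂ c₃ d₁ d₂ d₃ e : F, (fun p : F × F => c₀ + c₁ * p.1 + c₂ * p.1 ^ 2 +
      c₃ * p.1 ^ 3 + d₁ * p.2 + d₂ * p.2 ^ 2 + d₃ * p.2 ^ 3 + e * (p.1 * p.2)) ∈ L)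
    {P : F × F} {s : Finset (F × F)} (hP : P ∉ s) (hs : s.card ≤ 3) :
    ∃ φ ∈ L, φ P ≠ 0 ∧ ∀ Q ∈ s, φ Q = 0 := by
  classical
  obtain rfl | ⟨Q, R, S, rfl⟩ : s = ∅ ∨ ∃ Q R S, s = {Q, R, S} := by
    have h : s.card = 0 ∨ s.card = 1 ∨ s.card = 2 ∨ s.card = 3 := by omega
    rw [Finset.card_eq_zero, Finset.card_eq_one, Finset.card_eq_two, Finset.card_eq_three] at h
    obtain h | ⟨Q, rfl⟩ | ⟨Q, R, -, rfl⟩ | ⟨Q, R, S, -, -, -, rfl⟩ := h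
    · exact Or.inl h
    -- Smaller sets are padded by repetition, as `exists_separating` does not require Q, R, S to be
    -- distinct.
    · exact Or.inr ⟨Q, Q, Q, by simp⟩
    · exact Or.inr ⟨Q, R, R, by simp⟩
    · exact Or.inr ⟨Q, R, S, rfl⟩
  · exact ⟨_, hL 1 0 0 0 0 0 0 0, by simp, by simp⟩
  · simp only [Finset.mem_insert, Finset.mem_singleton, not_or] at hP
    obtain ⟨φ, h, h1, h2, h3, h4⟩ :=
      exists_separating hL (Ne.symm hP.1) (Ne.symm hP.2.1) (Ne.symm hP.2.2)
    exact ⟨φ, h, h1, by simp [h2, h3, h4]⟩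

end Separation

/-! ### Trace-norm coordinates and the dual distance. -/

section Points

variable {F K : Type*} [Field F] [Field K] [Algebra F K] [Fintype F] {q t : ℕ}

/-- Distinct evaluation points are neither equal nor conjugate. -/
theorem IsListing.eq_of_evalPoints (hF : Fintype.card F = q) {α : Fin q → F}
    {β : Fin ((q ^ 2 - q) / 2) → K} (h : IsListing q α β) (ht : t ≤ q)
    {i j : Fin (t + (q ^ 2 - q) / 2)}
    (hij : evalPoints q t ht α β i = evalPoints q t ht α β j ∨
      evalPoints q t ht α β i = evalPoints q t ht α β j ^ q) : i = j := by
  have hα : ∀ x : F, algebraMap F K x ^ q = algebraMap F K x := fun x => by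
    rw [← map_pow, ← hF, FiniteField.pow_card]
  have key := h.1
  induction i using Fin.addCases with
  | left i =>
    induction j using Fin.addCases with
    | left j =>
      simp only [evalPoints, Fin.append_left, hα, or_self] at hij
      have := key (a₁ := Sum.inl (Fin.castLE ht i)) (a₂ := Sum.inl (Fin.castLE ht j)) hij
      rw [Sum.inl.injEq] at this
      rw [Fin.castLE_injective ht this]
    | right j =>
      simp only [evalPoints, Fin.append_left, Fin.append_right] at hij
      obtain hij | hij := hij
      · cases key (a₁ := Sum.inl (Fin.castLE ht i)) (a₂ := Sum.inr (Sum.inl j)) hij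
      · cases key (a₁ := Sum.inl (Fin.castLE ht i)) (a₂ := Sum.inr (Sum.inr j)) hij
  | right i =>
    induction j using Fin.addCases with
    | left j =>
      simp only [evalPoints, Fin.append_left, Fin.append_right, hα, or_self] at hij
      cases key (a₁ := Sum.inr (Sum.inl i)) (a₂ := Sum.inl (Fin.castLE ht j)) hij
    | right j =>
      simp only [evalPoints, Fin.append_right] at hij
      obtain hij | hij := hij
      · cases key (a₁ := Sum.inr (Sum.inl i)) (a₂ := Sum.inr (Sum.inl j)) hij
        rfl
      · cases key (a₁ := Sum.inr (Sum.inl i)) (a₂ := Sum.inr (Sum.inr j)) hij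

variable [Fintype K] {m l : ℕ}

theorem aeval_mem_range_of_mem_VSpace (hF : Fintype.card F = q) (hK : Fintype.card K = q ^ 2)
    {α : Fin q → F} {β : Fin ((q ^ 2 - q) / 2) → K} (h : IsListing q α β) (hm : 1 ≤ m)
    (hl : l ≤ m - 1) {f : F[X]} (hf : f ∈ VSpace F q m l) (x : K) :
    aeval x f ∈ Set.range (algebraMap F K) :=
  h.mem_range_algebraMap hK (aeval_pow_eq_self_of_mem_VSpace hF hK hm hl hf x)

/-- The dual of the subcode has minimum distance at least five. -/
theorem five_le_hammingNorm [DecidableEq F] (hF : Fintype.card F = q)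
    (hK : Fintype.card K = q ^ 2) {α : Fin q → F} {β : Fin ((q ^ 2 - q) / 2) → K}
    (h : IsListing q α β) (ht : t ≤ q) {u : Fin (t + (q ^ 2 - q) / 2) → F}
    (hu : u ∈ euclideanDual (subCode q t ht α β)) (hu0 : u ≠ 0) : 5 ≤ hammingNorm u := by
  classical
  set P := evalPoints q t ht α β with hP
  have hgen : ∀ f ∈ ({1, X ^ (q + 1), X ^ (2 * (q + 1)), X ^ (3 * (q + 1)), X ^ q + X,
      X ^ (2 * q) + X ^ 2, X ^ (3 * q) + X ^ 3, X ^ (2 * q + 1) + X ^ (q + 2)} : Set F[X]),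
      f ∈ W8Space F q := fun f hf => Submodule.subset_span hf
  simp only [Set.mem_insert_iff, Set.mem_singleton_iff, forall_eq_or_imp, forall_eq] at hgen
  obtain ⟨g1, gN, gN2, gN3, gT, gT2, gT3, gTN⟩ := hgen
  have hval : ∀ f ∈ W8Space F q, ∀ x : K, aeval x f ∈ Set.range (algebraMap F K) := fun f hf =>
    aeval_mem_range_of_mem_VSpace hF hK h (m := 5) (l := 0) (by norm_num) (by norm_num)
      (W8Space_le_VSpace le_rfl hf)
  choose T hT using fun i => hval _ gT (P i)
  choose N hN using fun i => hval _ gN (P i)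
  simp only [map_add, aeval_X_pow, aeval_X] at hT hN
  have hN' : ∀ i, algebraMap F K (N i) = P i ^ q * P i := fun i => by rw [hN, pow_succ]
  let pt : Fin (t + (q ^ 2 - q) / 2) → F × F := fun i => (T i, N i)
  have hpt : Function.Injective pt := by
    intro i j hij
    have hTij : T i = T j := congrArg Prod.fst hij
    have hNij : N i = N j := congrArg Prod.snd hij
    refine h.eq_of_evalPoints hF ht ?_
    rw [← hP]
    have h1 : P i ^ q + P i = P j ^ q + P j := by rw [← hT, ← hT, hTij]
    have h2 : P i ^ q * P i = P j ^ q * P j := by rw [← hN', ← hN', hNij]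
    -- Equal trace and norm make P_i a root of the quadratic with roots P_j and P_j^q.
    have : (P i - P j) * (P i - P j ^ q) = 0 := by linear_combination P i * h1 - h2
    exact (mul_eq_zero.1 this).imp sub_eq_zero.1 sub_eq_zero.1
  let L : Submodule F (F × F → F) := (subCode q t ht α β).comap (LinearMap.funLeft F F pt)
  have hL : ∀ c₀ c₁ c₂ c₃ d₁ d₂ d₃ e : F, (fun p : F × F => c₀ + c₁ * p.1 + c₂ * p.1 ^ 2 +
      c₃ * p.1 ^ 3 + d₁ * p.2 + d₂ * p.2 ^ 2 + d₃ * p.2 ^ 3 + e * (p.1 * p.2)) ∈ L := by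
    intro c₀ c₁ c₂ c₃ d₁ d₂ d₃ e
    have sm := fun (c : F) {f : F[X]} (hf : f ∈ W8Space F q) => (W8Space F q).smul_mem c hf
    have ad := fun {f g : F[X]} (hf : f ∈ W8Space F q) (hg : g ∈ W8Space F q) =>
      (W8Space F q).add_mem hf hg
    -- With T = x^q + x and N = x^(q+1): T² = (x^(2q) + x²) + 2N, TN = x^(2q+1) + x^(q+2) and T³ =
    -- (x^(3q) + x³) + 3TN.
    refine ⟨_, ad (ad (ad (ad (ad (ad (ad (sm c₀ g1) (sm c₁ gT))
      (sm c₂ (ad gT2 (sm 2 gN)))) (sm c₃ (ad gT3 (sm 3 gTN))))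
      (sm d₁ gN)) (sm d₂ gN2)) (sm d₃ gN3)) (sm e gTN), fun i => ?_⟩
    rw [← hP]
    simp only [LinearMap.funLeft_apply, pt, map_add, map_mul, map_pow, hT, hN',
      Algebra.smul_def, map_one, aeval_X, map_ofNat, algebraMap_eq, aeval_C]
    rw [mul_comm 2 q, mul_comm 3 q]
    ring
  by_contra hlt
  obtain ⟨i₀, hi₀⟩ : ∃ i, u i ≠ 0 := by
    by_contra! hcon
    exact hu0 (funext hcon)
  set S := Finset.univ.filter fun i => u i ≠ 0 with hS
  have hcard : S.card ≤ 4 := by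
    have : hammingNorm u = S.card := rfl
    omega
  -- A codeword nonzero at i₀ and zero on the rest of the support of u contradicts its orthogonality
  -- to u.
  obtain ⟨φ, hφ, h1, h2⟩ := exists_separating_finset hL (P := pt i₀)
    (s := (S.erase i₀).map ⟨pt, hpt⟩)
    (by simp) (by
      rw [Finset.card_map, Finset.card_erase_of_mem (by simpa [hS] using hi₀)]
      omega)
  have hsum := hu _ hφ
  rw [Finset.sum_eq_single i₀ _ (by simp)] at hsum
  · exact mul_ne_zero hi₀ h1 hsum
  · intro i _ hi
    by_cases hui : u i = 0
    · rw [hui, zero_mul]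
    · rw [LinearMap.funLeft_apply, h2 (pt i), mul_zero]
      exact Finset.mem_map.2 ⟨i, by simp [hS, hi, hui], rfl⟩

end Points

end XingLing

/-! ### Assembly of the parameters. -/

theorem mainTheorem1 {F K : Type*} [Field F] [Fintype F] [DecidableEq F] [Field K] [Fintype K]
    [Algebra F K] (q t m l : ℕ) (hF : Fintype.card F = q) (hK : Fintype.card K = q ^ 2)
    (α : Fin q → F) (β : Fin ((q ^ 2 - q) / 2) → K) (hαβ : XingLing.IsListing q α β)
    (hq : 5 ≤ q) (ht : t ≤ q) (hm : 5 ≤ m) (hmq : m ≤ q - 1) (hl : l ≤ m - 1) :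
    XingLing.subCode q t ht α β < XingLing.xlCode q t m l ht α β ∧
    ∃ dz dx : ℕ,
      XingLing.designedDistance q t m l ≤ (dz : ℚ) ∧ 5 ≤ dx ∧
      XingLing.IsWtDiff (XingLing.xlCode q t m l ht α β) (XingLing.subCode q t ht α β) dz ∧
      XingLing.IsWtDiff (XingLing.euclideanDual (XingLing.subCode q t ht α β))
        (XingLing.euclideanDual (XingLing.xlCode q t m l ht α β)) dx ∧
      XingLing.IsAQC (t + (q ^ 2 - q) / 2) (m * (m - 1) / 2 + l - 7) dz dx
        (XingLing.cssCode (XingLing.euclideanDual (XingLing.subCode q t ht α β))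
          (XingLing.xlCode q t m l ht α β)) := by
  have hW := XingLing.W8Space_le_VSpace (F := F) (q := q) (l := l) hm
  have hle : XingLing.subCode q t ht α β ≤ XingLing.xlCode q t m l ht α β :=
    XingLing.evalCode_mono hW _
  have hval : ∀ f ∈ XingLing.VSpace F q m l, ∀ i,
      aeval (XingLing.evalPoints q t ht α β i) f ∈ Set.range (algebraMap F K) := fun f hf i =>
    XingLing.aeval_mem_range_of_mem_VSpace hF hK hαβ (by omega) hl hf _
  have hinj : ∀ f ∈ XingLing.VSpace F q m l,
      (∀ i, aeval (XingLing.evalPoints q t ht α β i) f = 0) → f = 0 := fun f hf h0 =>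
    XingLing.eq_zero_of_mem_VSpace hF hαβ (by omega) hl hmq hf fun j => by
      simpa [XingLing.evalPoints] using h0 (Fin.natAdd t j)
  have hdC : Module.finrank F (XingLing.xlCode q t m l ht α β) = m * (m - 1) / 2 + l + 1 :=
    (XingLing.finrank_evalCode _ _ hval hinj).trans
      (XingLing.finrank_VSpace (by omega) hl (by omega))
  have hdD : Module.finrank F (XingLing.subCode q t ht α β) = 8 :=
    (XingLing.finrank_evalCode _ _ (fun f hf => hval f (hW hf)) fun f hf => hinj f (hW hf)).trans
      (XingLing.finrank_W8Space (by omega))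
  -- The larger code has dimension at least 11 > 8, so the inclusion is strict and the subtraction
  -- of 7 is not truncated.
  have hten : 10 ≤ m * (m - 1) / 2 := by
    have : 5 * 4 ≤ m * (m - 1) := Nat.mul_le_mul hm (by omega)
    omega
  have hlt : XingLing.subCode q t ht α β < XingLing.xlCode q t m l ht α β := by
    refine lt_of_le_of_ne hle fun he => ?_
    rw [he, hdC] at hdD
    omega
  obtain ⟨dz, hdz⟩ := XingLing.exists_isWtDiff hlt
  obtain ⟨dx, hdx⟩ := XingLing.exists_isWtDiff (XingLing.euclideanDual_strictAnti hlt)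
  refine ⟨hlt, dz, dx, ?_, ?_, hdz, hdx, ?_⟩
  · obtain ⟨c, ⟨hc, hcD⟩, rfl⟩ := hdz.1
    refine XingLing.designedDistance_le_hammingNorm hF hαβ ht (by omega) (by omega) hl hc ?_
    rintro rfl
    exact hcD (Submodule.zero_mem _)
  · obtain ⟨u, ⟨hu, huC⟩, rfl⟩ := hdx.1
    refine XingLing.five_le_hammingNorm hF hK hαβ ht hu ?_
    rintro rfl
    exact huC (Submodule.zero_mem _)
  · have := XingLing.isAQC_cssCode hle hdz hdx
    rwa [hdC, hdD, Fintype.card_fin,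
      show m * (m - 1) / 2 + l + 1 - 8 = m * (m - 1) / 2 + l - 7 by omega] at this
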